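/- **Theorem.** Let $\varepsilon_1,\varepsilon_2,\dots$ be i.i.d. real random variables with $E\varepsilon_1=0$, $\operatorname{var}(\varepsilon_1)=\sigma^2$ and $E\varepsilon_1^4<\infty$. For each even sample size $n=2m$ let $\beta=\beta_n\in\mathbb R^{p}$ with $p=p_n$ arbitrary, let $X$ be a random $n\times p$ design matrix, and let $y=X\beta+\varepsilon$ with $\varepsilon=(\varepsilon_1,\dots,\varepsilon_n)^T$. Split the $n$ observations, deterministically or at random, into two groups $(y^{(1)},X^{(1)})$ and $(y^{(2)},X^{(2)})$ of $n/2$ observations each. Assume that $\varepsilon$ is independent of the pair formed by $X$ and the split. For a matrix $Z$ with $k$ rows and $p$ columns and a set $M\subseteq\{1,\dots,p\}$, let $Z_M$ consist of the columns of $Z$ indexed by $M$, and for $b\in\mathbb R$ put $$\phi_{\min}(Z,b)=\min_{1\le|M|\le b}\lambda_{\min}\Big(\tfrac1k Z_M^TZ_M\Big)$$ (with the value $+\infty$ if there is no such $M$). Assume that there are a constant $\lambda_0>0$ and a sequence $b_n$ with $b_n/n\to0$ such that, as $n\to\infty$, $$P\{\phi_{\min}(X^{(1)},b_n)\ge\lambda_0\}\to1\quad\text{and}\quad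 P\{\phi_{\min}(X^{(2)},b_n)\ge\lambda_0\}\to1$$ (in particular this holds if these probabilities equal $1$ for all $n$). Apply a measurable model selection procedure to each of the two groups, giving $\hat M_1$ (a function of $(y^{(1)},X^{(1)})$) and $\hat M_2$ (the same function of $(y^{(2)},X^{(2)})$). Suppose that it has the sure screening property: with $M_0=\{j:\beta_j\ne0\}$, $P(\hat M_1\supseteq M_0)\to1$ and $P(\hat M_2\supseteq M_0)\to1$ as $n\to\infty$; and suppose that, almost surely, $|\hat M_1|\le b_n$ and $|\hat M_2|\le b_n$ for every $n$. Put $P^{(k)}_{M}=X^{(k)}_{M}(X^{(k)T}_{M}X^{(k)}_{M})^{-1}X^{(k)T}_{M}$ and $$\hat\sigma_1^2=\frac{y^{(2)T}(I_{n/2}-P^{(2)}_{\hat M_1})y^{(2)}}{n/2-|\hat M_1|},\qquad \hat\sigma_2^2=\frac{y^{(1)T}(I_{n/2}-P^{(1)}_{\hat M_2})y^{(1)}}{n/2-|\hat M_2|},\qquad \hat\sigma^2_{\rm RCV}=\frac{\hat\sigma_1^2+\hat\sigma_2^2}{2}$$ (on the event, of probability tending to $0$, where an inverse or a quotient does not exist,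 it is given the value $0$). Then, as $n\to\infty$ through the even integers, $$\sqrt n\,(\hat\sigma^2_{\rm RCV}-\sigma^2)\ \to\ N(0,\ E\varepsilon_1^4-\sigma^4)\quad\text{in distribution},$$ and the oracle estimator $\hat\sigma_O^2=n^{-1}\sum_{i=1}^n(Y_i-x_i^T\beta)^2$, where $x_i^T$ is the $i$-th row of $X$, has the same limit: $\sqrt n\,(\hat\sigma_O^2-\sigma^2)\to N(0,E\varepsilon_1^4-\sigma^4)$ in distribution. -/

import Mathlib

open MeasureTheory ProbabilityTheory Filter Topology

noncomputable section

namespace RefittedCV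

open scoped Matrix

/-- The columns of `X` indexed by `M`. -/
def cols {n p : ℕ} (X : Matrix (Fin n) (Fin p) ℝ) (M : Finset (Fin p)) : Matrix (Fin n) M ℝ :=
  X.submatrix id Subtype.val

/-- Smallest eigenvalue of a square real matrix. The spectrum of a matrix is its set of
eigenvalues; the value is `⊤` for the empty matrix, which has none. -/
def lambdaMin {ι : Type*} [Fintype ι] [DecidableEq ι] (A : Matrix ι ι ℝ) : EReal :=
  ⨅ μ ∈ spectrum ℝ A, (μ : EReal)

/-- `φ_min(b)`: the minimum over `|M| ≤ b` of the smallest eigenvalue of `n⁻¹ X_Mᵀ X_M`. The empty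
model contributes `⊤`, so it imposes no restriction. -/
def phiMin {n p : ℕ} (X : Matrix (Fin n) (Fin p) ℝ) (b : ℝ) : EReal :=
  ⨅ (M : Finset (Fin p)) (_ : (M.card : ℝ) ≤ b),
    lambdaMin ((1 / (n : ℝ)) • ((cols X M)ᵀ * cols X M))

/-- The projection `P_M = X_M (X_Mᵀ X_M)⁻¹ X_Mᵀ`. -/
def proj {n p : ℕ} (X : Matrix (Fin n) (Fin p) ℝ) (M : Finset (Fin p)) :
    Matrix (Fin n) (Fin n) ℝ :=
  cols X M * ((cols X M)ᵀ * cols X M)⁻¹ * (cols X M)ᵀ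

/-- Least squares variance estimator in the model `M`: `yᵀ (I - P_M) y / (n - |M|)`. -/
def olsVariance {n p : ℕ} (X : Matrix (Fin n) (Fin p) ℝ) (y : Fin n → ℝ) (M : Finset (Fin p)) : ℝ :=
  (y ⬝ᵥ ((1 - proj X M) *ᵥ y)) / ((n : ℝ) - (M.card : ℝ))

/-- The true model `M₀ = {j : β_j ≠ 0}`. -/
def trueModel {p : ℕ} (β : Fin p → ℝ) : Finset (Fin p) :=
  Finset.univ.filter fun j => β j ≠ 0

/-- The responses of the linear model `y = X β + e`. -/
def response {n p : ℕ} (X : Matrix (Fin n) (Fin p) ℝ) (β : Fin p → ℝ) (e : Fin n → ℝ) :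
    Fin n → ℝ :=
  X *ᵥ β + e

/-- A model selection procedure for `m` observations of `p` covariates. -/
abbrev Selector (m p : ℕ) : Type :=
  Matrix (Fin m) (Fin p) ℝ → (Fin m → ℝ) → Finset (Fin p)

/-- The indices of a split of `2m` observations into two groups of `m`: `Sum.inl i` is sent to the
`i`-th member of the first group and `Sum.inr i` to the `i`-th member of the second one. -/
abbrev SplitMap (m : ℕ) : Type := Fin m ⊕ Fin m → Fin (2 * m)

section Halves

variable {m p : ℕ}

/-- Design matrix of the first group. -/
def X₁ (τ : SplitMap m) (X : Matrix (Fin (2 * m)) (Fin p) ℝ) : Matrix (Fin m) (Fin p) ℝ :=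
  X.submatrix (fun i => τ (Sum.inl i)) id

/-- Design matrix of the second group. -/
def X₂ (τ : SplitMap m) (X : Matrix (Fin (2 * m)) (Fin p) ℝ) : Matrix (Fin m) (Fin p) ℝ :=
  X.submatrix (fun i => τ (Sum.inr i)) id

/-- Responses of the first group. -/
def y₁ (τ : SplitMap m) (y : Fin (2 * m) → ℝ) : Fin m → ℝ := fun i => y (τ (Sum.inl i))

/-- Responses of the second group. -/
def y₂ (τ : SplitMap m) (y : Fin (2 * m) → ℝ) : Fin m → ℝ := fun i => y (τ (Sum.inr i))

/-- Model selected on the first group. -/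
def M₁ (sel : Selector m p) (τ : SplitMap m) (X : Matrix (Fin (2 * m)) (Fin p) ℝ)
    (y : Fin (2 * m) → ℝ) : Finset (Fin p) :=
  sel (X₁ τ X) (y₁ τ y)

/-- Model selected on the second group. -/
def M₂ (sel : Selector m p) (τ : SplitMap m) (X : Matrix (Fin (2 * m)) (Fin p) ℝ)
    (y : Fin (2 * m) → ℝ) : Finset (Fin p) :=
  sel (X₂ τ X) (y₂ τ y)

/-- The refitted cross-validation estimator: each selected model is refitted on the other group,
and the two variance estimators are averaged. -/
def rcv (sel : Selector m p) (τ : SplitMap m) (X : Matrix (Fin (2 * m)) (Fin p) ℝ)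
    (y : Fin (2 * m) → ℝ) : ℝ :=
  (olsVariance (X₂ τ X) (y₂ τ y) (M₁ sel τ X y) +
    olsVariance (X₁ τ X) (y₁ τ y) (M₂ sel τ X y)) / 2

end Halves

/-- The oracle estimator `n⁻¹ ∑ᵢ (Yᵢ - xᵢᵀ β)²`. -/
def oracle {n p : ℕ} (β : Fin p → ℝ) (X : Matrix (Fin n) (Fin p) ℝ) (y : Fin n → ℝ) : ℝ :=
  (n : ℝ)⁻¹ * ∑ i, (y i - X i ⬝ᵥ β) ^ 2

end RefittedCV

end

/-! Write `n = 2m`. For the oracle, `√n (σ̂_O² - σ²) = n^{-1/2} (∑ ε_i² - nσ²)`, and the central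
limit theorem for the squares gives a normal limit with variance `var(ε²) = E ε⁴ - σ⁴`. It remains
to see that refitting costs only `o_P(n^{-1/2})` in each group.

Suppose the model `M`, of size `k`, contains the true model and has a nonsingular Gram matrix in the
group of refitting. Then `I - P_M` annihilates the signal, and the variance estimator minus `eᵀe /
m` equals `eᵀ A e / (m - k)` with `A = (k/m) I - P_M` (`olsVariance_response_sub`). The matrix `A`
has trace `0` and squared Frobenius norm `k - k²/m ≤ k`.

Sample splitting makes `A` harmless: it depends on the design, the split and the noise of the other
group, all independent of `e`. With these frozen, `eᵀ A e` is centred with second moment at most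
`(var(ε²) + 2σ⁴) k` (`integral_sq_centredQuadForm_le`). Chebyshev's inequality gives a bound uniform
in the frozen values, which Fubini transfers to the random ones (`measure_largeRefit_le`). After
scaling, the bound is of order `b_n / n → 0`, and Slutsky's theorem concludes. -/

namespace RefittedCV

open scoped Matrix

/-! ### Projections and the algebra of the refitted estimator -/

section LinearAlgebra

variable {n p : ℕ}

/-- The Gram matrix `X_Mᵀ X_M`. -/
def gram (X : Matrix (Fin n) (Fin p) ℝ) (M : Finset (Fin p)) : Matrix M M ℝ :=
  (cols X M)ᵀ * cols X M

lemma proj_eq (X : Matrix (Fin n) (Fin p) ℝ) (M : Finset (Fin p)) :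
    proj X M = cols X M * (gram X M)⁻¹ * (cols X M)ᵀ := rfl

lemma proj_transpose (X : Matrix (Fin n) (Fin p) ℝ) (M : Finset (Fin p)) :
    (proj X M)ᵀ = proj X M := by
  simp [proj, Matrix.transpose_mul, Matrix.transpose_nonsing_inv, Matrix.mul_assoc]

lemma proj_mul_cols {X : Matrix (Fin n) (Fin p) ℝ} {M : Finset (Fin p)}
    (h : (gram X M).det ≠ 0) : proj X M * cols X M = cols X M := by
  rw [proj_eq, Matrix.mul_assoc, ← gram, Matrix.mul_assoc,
    Matrix.nonsing_inv_mul _ (isUnit_iff_ne_zero.mpr h), Matrix.mul_one]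

lemma proj_mul_self {X : Matrix (Fin n) (Fin p) ℝ} {M : Finset (Fin p)}
    (h : (gram X M).det ≠ 0) : proj X M * proj X M = proj X M := by
  nth_rw 2 [proj_eq]
  rw [← Matrix.mul_assoc, ← Matrix.mul_assoc, proj_mul_cols h, ← proj_eq]

lemma trace_proj {X : Matrix (Fin n) (Fin p) ℝ} {M : Finset (Fin p)}
    (h : (gram X M).det ≠ 0) : (proj X M).trace = M.card := by
  rw [proj_eq, Matrix.trace_mul_comm, ← Matrix.mul_assoc, ← gram,
    Matrix.mul_nonsing_inv _ (isUnit_iff_ne_zero.mpr h), Matrix.trace_one]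
  simp

/-- The mean of a response whose true model is contained in `M` is a combination of the columns
in `M`. -/
lemma mulVec_eq_cols_mulVec (X : Matrix (Fin n) (Fin p) ℝ) {β : Fin p → ℝ} {M : Finset (Fin p)}
    (h : trueModel β ⊆ M) : X *ᵥ β = cols X M *ᵥ fun j => β j := by
  ext i
  simp only [Matrix.mulVec, dotProduct, cols, Matrix.submatrix_apply, id]
  rw [Finset.sum_coe_sort M (fun j => X i j * β j)]
  refine (Finset.sum_subset (Finset.subset_univ _) fun j _ hj => ?_).symm
  have : β j = 0 := by
    by_contra hne
    exact hj (h (by simp [trueModel, hne]))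
  simp [this]

/-- The matrix `(|M| / n) I - P_M`; its trace vanishes when the Gram matrix is invertible. -/
noncomputable def centredProj (X : Matrix (Fin n) (Fin p) ℝ) (M : Finset (Fin p)) :
    Matrix (Fin n) (Fin n) ℝ :=
  ((M.card : ℝ) / n) • (1 : Matrix (Fin n) (Fin n) ℝ) - proj X M

lemma centredProj_transpose (X : Matrix (Fin n) (Fin p) ℝ) (M : Finset (Fin p)) :
    (centredProj X M)ᵀ = centredProj X M := by
  simp [centredProj, proj_transpose]

lemma trace_centredProj {X : Matrix (Fin n) (Fin p) ℝ} {M : Finset (Fin p)} (hn : n ≠ 0)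
    (h : (gram X M).det ≠ 0) : (centredProj X M).trace = 0 := by
  have : (n : ℝ) ≠ 0 := by exact_mod_cast hn
  simp [centredProj, trace_proj h, Matrix.trace_sub, Matrix.trace_smul, this]

/-- With `c = k/n`, idempotence and trace `k` of the projection give `tr (c I - P)² = c² n - 2ck + k
= k - k²/n`. -/
lemma sum_sq_centredProj_le {X : Matrix (Fin n) (Fin p) ℝ} {M : Finset (Fin p)} (hn : n ≠ 0)
    (h : (gram X M).det ≠ 0) : ∑ i, ∑ j, centredProj X M i j ^ 2 ≤ M.card := by
  have hn' : (n : ℝ) ≠ 0 := by exact_mod_cast hn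
  have htr : ∑ i, ∑ j, centredProj X M i j ^ 2
      = (centredProj X M * (centredProj X M)ᵀ).trace := by
    simp [Matrix.trace, Matrix.mul_apply, pow_two]
  have hsq : (centredProj X M * centredProj X M).trace
      = (M.card : ℝ) - (M.card : ℝ) ^ 2 / n := by
    simp only [centredProj, sub_mul, mul_sub, Matrix.smul_mul, Matrix.mul_smul, Matrix.one_mul,
      Matrix.mul_one, proj_mul_self h, Matrix.trace_sub, Matrix.trace_smul, trace_proj h,
      Matrix.trace_one, Fintype.card_fin, smul_eq_mul]
    field_simp
    ring
  rw [htr, centredProj_transpose, hsq]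
  have : 0 ≤ (M.card : ℝ) ^ 2 / n := by positivity
  linarith

/-- When `M` contains the true model, the least squares variance estimator differs from the mean
of the squared noise by a quadratic form in the noise. -/
lemma olsVariance_response_sub {X : Matrix (Fin n) (Fin p) ℝ} {β : Fin p → ℝ}
    {M : Finset (Fin p)} (hn : n ≠ 0) (e : Fin n → ℝ) (h : (gram X M).det ≠ 0)
    (hM : trueModel β ⊆ M) (hcard : (M.card : ℝ) < n) :
    olsVariance X (response X β e) M - (e ⬝ᵥ e) / n
      = (e ⬝ᵥ (centredProj X M *ᵥ e)) / ((n : ℝ) - M.card) := by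
  have hn' : (n : ℝ) ≠ 0 := by exact_mod_cast hn
  have hk : (n : ℝ) - M.card ≠ 0 := by linarith
  have hres : (1 - proj X M) *ᵥ (X *ᵥ β) = 0 := by
    rw [mulVec_eq_cols_mulVec X hM, Matrix.mulVec_mulVec, Matrix.sub_mul, proj_mul_cols h]
    simp
  have hsymm : ∀ u v : Fin n → ℝ, u ⬝ᵥ ((1 - proj X M) *ᵥ v) = ((1 - proj X M) *ᵥ u) ⬝ᵥ v := by
    intro u v
    rw [Matrix.dotProduct_mulVec, ← Matrix.mulVec_transpose]
    simp [proj_transpose]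
  have hq : response X β e ⬝ᵥ ((1 - proj X M) *ᵥ response X β e)
      = e ⬝ᵥ e - e ⬝ᵥ (proj X M *ᵥ e) := by
    rw [response, Matrix.mulVec_add, hres, zero_add, add_dotProduct, hsymm, hres, zero_dotProduct,
      zero_add, Matrix.sub_mulVec, Matrix.one_mulVec, dotProduct_sub]
  -- With `a = eᵀe` and `q = eᵀPe`, what remains is `(a - q)/(n - k) - a/n = ((k/n) a - q)/(n - k)`.
  rw [olsVariance, hq, centredProj, Matrix.sub_mulVec, Matrix.smul_mulVec, Matrix.one_mulVec,
    dotProduct_sub, dotProduct_smul, smul_eq_mul]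
  field_simp
  ring

/-- A singular Gram matrix would have the eigenvalue `0 < lam`. Nonsingularity is all that the
argument takes from the sparse eigenvalue condition. -/
lemma det_gram_ne_zero_of_phiMin {X : Matrix (Fin n) (Fin p) ℝ} {b lam : ℝ}
    (hlam : 0 < lam) (h : (lam : EReal) ≤ phiMin X b) {M : Finset (Fin p)}
    (hM : (M.card : ℝ) ≤ b) : (gram X M).det ≠ 0 := by
  intro hdet
  have h1 : (lam : EReal) ≤ lambdaMin ((1 / (n : ℝ)) • gram X M) :=
    h.trans (iInf₂_le M hM)
  have h2 : (0 : ℝ) ∈ spectrum ℝ ((1 / (n : ℝ)) • gram X M) := by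
    rw [spectrum.zero_mem_iff, Matrix.isUnit_iff_isUnit_det, Matrix.det_smul, hdet]
    simp
  have h3 : lambdaMin ((1 / (n : ℝ)) • gram X M) ≤ ((0 : ℝ) : EReal) := iInf₂_le _ h2
  have := EReal.coe_le_coe_iff.1 (h1.trans h3)
  linarith

end LinearAlgebra

/-! ### Second moments of quadratic forms in independent variables -/

section QuadraticForm

variable {Ω : Type*} [MeasurableSpace Ω] {P : Measure Ω} [IsProbabilityMeasure P]

instance holderTriple_four_four_two : ENNReal.HolderTriple 4 4 2 where
  inv_add_inv_eq_inv := by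
    have h : (4 : ENNReal) = 2 * 2 := by norm_num
    rw [h, ENNReal.mul_inv (by simp) (by simp), ← mul_add, ENNReal.inv_two_add_inv_two, mul_one]

lemma memLp_sq_sub_const {W : Ω → ℝ} (hW : MemLp W 4 P) (v : ℝ) :
    MemLp (fun ω => W ω ^ 2 - v) 2 P := by
  have h : MemLp (fun ω => W ω * W ω) 2 P := hW.mul' hW
  simp only [pow_two]
  exact h.sub (memLp_const v)

/-- Second moment of an increment of a centred quadratic form. -/
lemma integral_sq_add_increment {Q L W : Ω → ℝ} {v : ℝ} (c : ℝ)
    (hQ : MemLp Q 2 P) (hL : MemLp L 4 P) (hW : MemLp W 4 P)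
    (hind : IndepFun (fun ω => (Q ω, L ω)) W P)
    (hW1 : ∫ ω, W ω ∂P = 0) (hW2 : ∫ ω, W ω ^ 2 ∂P = v) (hL1 : ∫ ω, L ω ∂P = 0) :
    ∫ ω, (Q ω + c * (W ω ^ 2 - v) + 2 * (W ω * L ω)) ^ 2 ∂P
      = ∫ ω, Q ω ^ 2 ∂P + c ^ 2 * ∫ ω, (W ω ^ 2 - v) ^ 2 ∂P + 4 * v * ∫ ω, L ω ^ 2 ∂P := by
  have hD : MemLp (fun ω => W ω ^ 2 - v) 2 P := memLp_sq_sub_const hW v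
  have hWL : MemLp (fun ω => W ω * L ω) 2 P := hL.mul' hW
  have hW2' : Integrable (fun ω => W ω ^ 2) P :=
    (hW.mono_exponent (p := 2) (by norm_num)).integrable_sq
  have hD0 : ∫ ω, (W ω ^ 2 - v) ∂P = 0 := by
    rw [integral_sub hW2' (integrable_const _), hW2]; simp
  have mQ := hQ.aestronglyMeasurable
  have mL := hL.aestronglyMeasurable
  have mW := hW.aestronglyMeasurable
  have mD := hD.aestronglyMeasurable
  have i1 : ∫ ω, Q ω * (W ω ^ 2 - v) ∂P = 0 := by
    have h : IndepFun Q (fun ω => W ω ^ 2 - v) P :=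
      hind.comp (φ := Prod.fst) (ψ := fun w => w ^ 2 - v) (by fun_prop) (by fun_prop)
    rw [h.integral_fun_mul_eq_mul_integral mQ mD, hD0, mul_zero]
  have i2 : ∫ ω, Q ω * (W ω * L ω) ∂P = 0 := by
    have h : IndepFun (fun ω => Q ω * L ω) W P :=
      hind.comp (φ := fun x : ℝ × ℝ => x.1 * x.2) (ψ := fun w => w) (by fun_prop) (by fun_prop)
    have h' := h.integral_fun_mul_eq_mul_integral (mQ.mul mL) mW
    rw [hW1, mul_zero] at h'
    rw [← h']
    exact integral_congr_ae (ae_of_all _ fun ω => by ring)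
  -- The third moment of `W` need not vanish: `L` is independent of `W` and has mean zero.
  have i3 : ∫ ω, (W ω ^ 2 - v) * (W ω * L ω) ∂P = 0 := by
    have h : IndepFun L (fun ω => (W ω ^ 2 - v) * W ω) P :=
      hind.comp (φ := Prod.snd) (ψ := fun w => (w ^ 2 - v) * w) (by fun_prop) (by fun_prop)
    have h' := h.integral_fun_mul_eq_mul_integral mL (mD.mul mW)
    rw [hL1, zero_mul] at h'
    rw [← h']
    exact integral_congr_ae (ae_of_all _ fun ω => by ring)
  have i4 : ∫ ω, (W ω * L ω) ^ 2 ∂P = v * ∫ ω, L ω ^ 2 ∂P := by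
    have h : IndepFun (fun ω => L ω ^ 2) (fun ω => W ω ^ 2) P :=
      hind.comp (φ := fun x : ℝ × ℝ => x.2 ^ 2) (ψ := fun w => w ^ 2) (by fun_prop) (by fun_prop)
    have h' := h.integral_fun_mul_eq_mul_integral (mL.pow 2) (mW.pow 2)
    rw [hW2, mul_comm] at h'
    rw [← h']
    exact integral_congr_ae (ae_of_all _ fun ω => by ring)
  have e : ∀ ω, (Q ω + c * (W ω ^ 2 - v) + 2 * (W ω * L ω)) ^ 2
      = Q ω ^ 2 + c ^ 2 * (W ω ^ 2 - v) ^ 2 + 4 * (W ω * L ω) ^ 2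
        + 2 * c * (Q ω * (W ω ^ 2 - v)) + 4 * (Q ω * (W ω * L ω))
        + 4 * c * ((W ω ^ 2 - v) * (W ω * L ω)) := fun ω => by ring
  have j1 := hQ.integrable_sq
  have j2 := hD.integrable_sq.const_mul (c ^ 2)
  have j3 := hWL.integrable_sq.const_mul 4
  have j4 := (hQ.integrable_mul hD).const_mul (2 * c)
  have j5 := (hQ.integrable_mul hWL).const_mul 4
  have j6 := (hD.integrable_mul hWL).const_mul (4 * c)
  simp only [Pi.mul_apply] at j4 j5 j6
  simp_rw [e]
  rw [integral_add, integral_add, integral_add, integral_add, integral_add j1 j2]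
  · simp only [integral_const_mul, i1, i2, i3, i4]
    ring
  exacts [j1.add j2, j3, (j1.add j2).add j3, j4, ((j1.add j2).add j3).add j4, j5,
    (((j1.add j2).add j3).add j4).add j5, j6]

variable {ι : Type*}

/-- The quadratic form `∑_{i, j ∈ s} A i j x i x j`, centred at `v ∑_{i ∈ s} A i i`. -/
def centredQuadForm (A : ι → ι → ℝ) (v : ℝ) (s : Finset ι) (x : ι → ℝ) : ℝ :=
  ∑ i ∈ s, ∑ j ∈ s, A i j * x i * x j - v * ∑ i ∈ s, A i i

/-- Adding one index produces a diagonal term and, by symmetry, twice a product of `x a` with a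
linear form in the earlier variables. This feeds the induction with `integral_sq_add_increment`. -/
lemma centredQuadForm_insert [DecidableEq ι] {A : ι → ι → ℝ} (hA : ∀ i j, A i j = A j i) (v : ℝ)
    {s : Finset ι} {a : ι} (ha : a ∉ s) (x : ι → ℝ) :
    centredQuadForm A v (insert a s) x = centredQuadForm A v s x + A a a * (x a ^ 2 - v)
      + 2 * (x a * ∑ i ∈ s, A a i * x i) := by
  have h : ∑ i ∈ s, A i a * x i * x a = x a * ∑ i ∈ s, A a i * x i := by
    rw [Finset.mul_sum]
    exact Finset.sum_congr rfl fun i _ => by rw [hA i a]; ring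
  have h' : ∑ i ∈ s, A a i * x a * x i = x a * ∑ i ∈ s, A a i * x i := by
    rw [Finset.mul_sum]
    exact Finset.sum_congr rfl fun i _ => by ring
  simp only [centredQuadForm, Finset.sum_insert ha, Finset.sum_add_distrib, h, h']
  ring

variable {e : ι → Ω → ℝ} {v V : ℝ}

lemma integral_sq_linear (hind : iIndepFun e P) (hL4 : ∀ i, MemLp (e i) 4 P)
    (hmean : ∀ i, ∫ ω, e i ω ∂P = 0) (hsq : ∀ i, ∫ ω, e i ω ^ 2 ∂P = v)
    (c : ι → ℝ) (s : Finset ι) :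
    ∫ ω, (∑ i ∈ s, c i * e i ω) ^ 2 ∂P = v * ∑ i ∈ s, c i ^ 2 := by
  have hL2 : ∀ i, MemLp (e i) 2 P := fun i => (hL4 i).mono_exponent (by norm_num)
  have hvar : ∀ i, Var[fun ω => c i * e i ω; P] = c i ^ 2 * v := by
    intro i
    rw [variance_const_mul, variance_of_integral_eq_zero (hL2 i).aemeasurable (hmean i), hsq]
  have hs := IndepFun.variance_sum (X := fun i ω => c i * e i ω) (s := s) (μ := P)
    (fun i _ => (hL2 i).const_mul (c i))
    (fun i _ j _ hij => (hind.indepFun hij).comp (φ := fun x => c i * x) (ψ := fun x => c j * x)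
      (by fun_prop) (by fun_prop))
  have h0 : ∫ ω, (∑ i ∈ s, fun ω => c i * e i ω) ω ∂P = 0 := by
    simp only [Finset.sum_apply]
    rw [integral_finsetSum _ fun i _ => ((hL2 i).integrable (by norm_num)).const_mul (c i)]
    simp [integral_const_mul, hmean]
  rw [variance_of_integral_eq_zero _ h0] at hs
  · simp only [Finset.sum_apply, hvar] at hs
    rw [hs, Finset.mul_sum]
    exact Finset.sum_congr rfl fun i _ => mul_comm _ _
  · exact (memLp_finsetSum' s fun i _ => (hL2 i).const_mul (c i)).aemeasurable

lemma memLp_centredQuadForm (hL4 : ∀ i, MemLp (e i) 4 P) (A : ι → ι → ℝ) (s : Finset ι) :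
    MemLp (fun ω => centredQuadForm A v s fun i => e i ω) 2 P := by
  unfold centredQuadForm
  refine MemLp.sub (memLp_finsetSum s fun i _ => memLp_finsetSum s fun j _ => ?_)
    (memLp_const _)
  exact (hL4 j).mul' ((hL4 i).const_mul (A i j))

/-- Second moment bound for quadratic forms in independent centred random variables. -/
lemma integral_sq_centredQuadForm_le (hind : iIndepFun e P) (hL4 : ∀ i, MemLp (e i) 4 P)
    (hmean : ∀ i, ∫ ω, e i ω ∂P = 0) (hsq : ∀ i, ∫ ω, e i ω ^ 2 ∂P = v)
    (hV : ∀ i, ∫ ω, (e i ω ^ 2 - v) ^ 2 ∂P = V) {A : ι → ι → ℝ} (hA : ∀ i j, A i j = A j i)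
    (s : Finset ι) :
    ∫ ω, centredQuadForm A v s (fun i => e i ω) ^ 2 ∂P
      ≤ (V + 2 * v ^ 2) * ∑ i ∈ s, ∑ j ∈ s, A i j ^ 2 := by
  classical
  induction s using Finset.induction_on with
  | empty => simp [centredQuadForm]
  | insert a s ha ih =>
    have hm : ∀ i, AEMeasurable (e i) P := fun i => (hL4 i).aemeasurable
    have hL : MemLp (fun ω => ∑ i ∈ s, A a i * e i ω) 4 P :=
      memLp_finsetSum s fun i _ => (hL4 i).const_mul _
    have hL1 : ∫ ω, ∑ i ∈ s, A a i * e i ω ∂P = 0 := by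
      rw [integral_finsetSum _ fun i _ => ((hL4 i).integrable (by norm_num)).const_mul _]
      simp [integral_const_mul, hmean]
    -- The old form and the linear form involve only indices in `s`, and `a ∉ s`.
    have hI : IndepFun (fun ω => (centredQuadForm A v s (fun i => e i ω),
        ∑ i ∈ s, A a i * e i ω)) (e a) P := by
      have h := hind.indepFun_finset₀ s {a} (by simpa using ha) hm
      have hφ : Measurable fun x : s → ℝ => (∑ i : s, ∑ j : s, A i j * x i * x j
          - v * ∑ i ∈ s, A i i, ∑ i : s, A a i * x i) := by fun_prop
      have hψ : Measurable fun x : ({a} : Finset ι) → ℝ => x ⟨a, Finset.mem_singleton_self a⟩ :=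
        measurable_pi_apply _
      have h' := h.comp hφ hψ
      convert! h' using 1
      ext ω
      · simp only [centredQuadForm, Function.comp]
        rw [← Finset.sum_coe_sort s]
        congr 1
        exact Finset.sum_congr rfl fun i _ => (Finset.sum_coe_sort s _).symm
      · exact (Finset.sum_coe_sort s _).symm
    simp_rw [centredQuadForm_insert hA v ha]
    rw [integral_sq_add_increment (A a a) (memLp_centredQuadForm hL4 A s) hL (hL4 a) hI (hmean a)
      (hsq a) hL1, integral_sq_linear hind hL4 hmean hsq, hV]
    have hsum : ∑ i ∈ insert a s, ∑ j ∈ insert a s, A i j ^ 2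
        = ∑ i ∈ s, ∑ j ∈ s, A i j ^ 2 + A a a ^ 2 + 2 * ∑ i ∈ s, A a i ^ 2 := by
      have : ∑ i ∈ s, A i a ^ 2 = ∑ i ∈ s, A a i ^ 2 :=
        Finset.sum_congr rfl fun i _ => by rw [hA]
      simp only [Finset.sum_insert ha, Finset.sum_add_distrib, this]
      ring
    rw [hsum]
    -- The increment is `V A_aa² + 4v² ∑ A_ai²`; the right side grows by `(V + 2v²)(A_aa² + 2 ∑
    -- A_ai²)`. The surplus `2v² A_aa² + 2V ∑ A_ai²` is nonnegative.
    have hV0 : 0 ≤ V := (hV a) ▸ integral_nonneg fun ω => sq_nonneg _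
    have h1 : 0 ≤ V * ∑ i ∈ s, A a i ^ 2 := by positivity
    have h2 : 0 ≤ v ^ 2 * A a a ^ 2 := by positivity
    linarith

/-- Chebyshev's inequality for quadratic forms in independent centred random variables. -/
lemma measure_abs_centredQuadForm_ge_le (hind : iIndepFun e P) (hL4 : ∀ i, MemLp (e i) 4 P)
    (hmean : ∀ i, ∫ ω, e i ω ∂P = 0) (hsq : ∀ i, ∫ ω, e i ω ^ 2 ∂P = v)
    (hV : ∀ i, ∫ ω, (e i ω ^ 2 - v) ^ 2 ∂P = V) {A : ι → ι → ℝ} (hA : ∀ i j, A i j = A j i)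
    (s : Finset ι) {δ : ℝ} (hδ : 0 < δ) :
    P {ω | δ ≤ |centredQuadForm A v s fun i => e i ω|}
      ≤ ENNReal.ofReal ((V + 2 * v ^ 2) * (∑ i ∈ s, ∑ j ∈ s, A i j ^ 2) / δ ^ 2) := by
  have h := mul_meas_ge_le_integral_of_nonneg (μ := P)
    (ae_of_all _ fun ω => sq_nonneg (centredQuadForm A v s fun i => e i ω))
    (memLp_centredQuadForm hL4 A s).integrable_sq (δ ^ 2)
  have hset : {ω | δ ≤ |centredQuadForm A v s fun i => e i ω|}
      = {ω | δ ^ 2 ≤ (centredQuadForm A v s fun i => e i ω) ^ 2} := by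
    ext ω
    simp only [Set.mem_ofPred_eq]
    rw [sq_le_sq, abs_of_pos hδ]
  rw [hset, ← ofReal_measureReal]
  refine ENNReal.ofReal_le_ofReal ?_
  rw [le_div_iff₀ (by positivity), mul_comm]
  exact h.trans (integral_sq_centredQuadForm_le hind hL4 hmean hsq hV hA s)

end QuadraticForm

/-! ### Measurability of estimators, selected models and splits -/

section Measurability

variable {α : Type*} [MeasurableSpace α]

/-- Models and splits take finitely many values, so each may be held fixed when checking
measurability. This also removes the dependence of the Gram matrix's index type on the model. -/
lemma measurable_countable_param {κ γ : Type*} [Countable κ] [MeasurableSpace κ]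
    [MeasurableSingletonClass κ] [MeasurableSpace γ] {f : κ → α → γ} (hf : ∀ k, Measurable (f k))
    {g : α → κ} (hg : Measurable g) : Measurable fun a => f (g a) a := by
  have h : Measurable fun q : α × κ => f q.2 q.1 := measurable_from_prod_countable_left hf
  exact h.comp (measurable_id.prodMk hg)

lemma measurable_det {ι : Type*} [Fintype ι] [DecidableEq ι] {A : α → Matrix ι ι ℝ}
    (hA : ∀ i j, Measurable fun a => A a i j) : Measurable fun a => (A a).det := by
  simp only [Matrix.det_apply]
  exact Finset.measurable_fun_sum _ fun s _ =>
    (Finset.measurable_fun_prod _ fun i _ => hA _ _).const_smul _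

/-- By Cramer's rule the entries are quotients of determinants. The value `0` at singular matrices
agrees with `0⁻¹ = 0`, so no invertibility is needed. -/
lemma measurable_inv_apply {ι : Type*} [Fintype ι] [DecidableEq ι] {A : α → Matrix ι ι ℝ}
    (hA : ∀ i j, Measurable fun a => A a i j) (i j : ι) :
    Measurable fun a => (A a)⁻¹ i j := by
  simp only [Matrix.inv_def, Ring.inverse_eq_inv', Matrix.smul_apply, smul_eq_mul,
    Matrix.adjugate_apply]
  refine (measurable_det hA).inv.mul (measurable_det fun k l => ?_)
  simp only [Matrix.updateRow_apply]
  split_ifs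
  · exact measurable_const
  · exact hA k l

lemma measurable_mul_apply {ι κ ν : Type*} [Fintype κ] {A : α → Matrix ι κ ℝ}
    {B : α → Matrix κ ν ℝ} (hA : ∀ i j, Measurable fun a => A a i j)
    (hB : ∀ i j, Measurable fun a => B a i j) (i : ι) (j : ν) :
    Measurable fun a => (A a * B a) i j := by
  simp only [Matrix.mul_apply]
  exact Finset.measurable_fun_sum _ fun k _ => (hA i k).mul (hB k j)

lemma measurable_dotProduct_mulVec {ι : Type*} [Fintype ι] {A : α → Matrix ι ι ℝ}
    {y : α → ι → ℝ} (hA : ∀ i j, Measurable fun a => A a i j) (hy : Measurable y) :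
    Measurable fun a => y a ⬝ᵥ (A a *ᵥ y a) := by
  simp only [dotProduct, Matrix.mulVec]
  have hy' := measurable_pi_iff.1 hy
  exact Finset.measurable_fun_sum _ fun i _ => (hy' i).mul
    (Finset.measurable_fun_sum _ fun j _ => (hA i j).mul (hy' j))

variable {n p : ℕ} {X : α → Matrix (Fin n) (Fin p) ℝ} {M : α → Finset (Fin p)}

lemma measurable_gram_apply (hX : ∀ i j, Measurable fun a => X a i j) (N : Finset (Fin p))
    (i j : N) : Measurable fun a => gram (X a) N i j :=
  measurable_mul_apply (A := fun a => (cols (X a) N)ᵀ) (B := fun a => cols (X a) N)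
    (fun i j => hX j i) (fun i j => hX i j) i j

lemma measurable_det_gram (hX : ∀ i j, Measurable fun a => X a i j) (hM : Measurable M) :
    Measurable fun a => (gram (X a) (M a)).det :=
  measurable_countable_param (f := fun N a => (gram (X a) N).det)
    (fun N => measurable_det (measurable_gram_apply hX N)) hM

lemma measurable_proj_apply (hX : ∀ i j, Measurable fun a => X a i j) (hM : Measurable M)
    (i j : Fin n) : Measurable fun a => proj (X a) (M a) i j :=
  measurable_countable_param (f := fun N a => proj (X a) N i j)
    (fun N => measurable_mul_apply (A := fun a => cols (X a) N * (gram (X a) N)⁻¹)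
      (B := fun a => (cols (X a) N)ᵀ)
      (measurable_mul_apply (fun i j => hX i j)
        (measurable_inv_apply (measurable_gram_apply hX N))) (fun i j => hX j i) i j) hM

lemma measurable_card (hM : Measurable M) : Measurable fun a => ((M a).card : ℝ) :=
  (measurable_from_top (f := fun k : ℕ => (k : ℝ))).comp
    ((measurable_of_countable (f := fun N : Finset (Fin p) => N.card)).comp hM)

lemma measurable_centredProj_apply (hX : ∀ i j, Measurable fun a => X a i j) (hM : Measurable M)
    (i j : Fin n) : Measurable fun a => centredProj (X a) (M a) i j := by
  simp only [centredProj, Matrix.sub_apply, Matrix.smul_apply, smul_eq_mul]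
  exact (((measurable_card hM).div_const _).mul_const _).sub (measurable_proj_apply hX hM i j)

lemma measurable_olsVariance {y : α → Fin n → ℝ} (hX : ∀ i j, Measurable fun a => X a i j)
    (hy : Measurable y) (hM : Measurable M) :
    Measurable fun a => olsVariance (X a) (y a) (M a) := by
  refine (measurable_dotProduct_mulVec (fun i j => ?_) hy).div
    (measurable_const.sub (measurable_card hM))
  simp only [Matrix.sub_apply]
  exact measurable_const.sub (measurable_proj_apply hX hM i j)

lemma measurable_response {e : α → Fin n → ℝ} (hX : ∀ i j, Measurable fun a => X a i j)
    (β : Fin p → ℝ) (he : Measurable e) : Measurable fun a => response (X a) β (e a) := by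
  refine measurable_pi_iff.2 fun i => ?_
  simp only [response, Pi.add_apply, Matrix.mulVec, dotProduct]
  exact (Finset.measurable_fun_sum _ fun j _ => (hX i j).mul_const _).add
    (measurable_pi_iff.1 he i)

lemma measurable_selector {sel : Selector n p}
    (hsel : ∀ N : Finset (Fin p), MeasurableSet
      {d : (Fin n → Fin p → ℝ) × (Fin n → ℝ) | sel (Matrix.of d.1) d.2 = N})
    {y : α → Fin n → ℝ} (hX : ∀ i j, Measurable fun a => X a i j) (hy : Measurable y) :
    Measurable fun a => sel (X a) (y a) := by
  refine measurable_to_countable' fun N => ?_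
  have h : Measurable fun a => ((fun i j => X a i j : Fin n → Fin p → ℝ), y a) :=
    (measurable_pi_iff.2 fun i => measurable_pi_iff.2 fun j => hX i j).prodMk hy
  exact h (hsel N)

variable {m : ℕ}

lemma measurable_X₁_apply {τ : α → SplitMap m} {X : α → Matrix (Fin (2 * m)) (Fin p) ℝ}
    (hτ : Measurable τ) (hX : ∀ i j, Measurable fun a => X a i j) (i : Fin m) (j : Fin p) :
    Measurable fun a => X₁ (τ a) (X a) i j :=
  measurable_countable_param (f := fun (t : SplitMap m) a => X₁ t (X a) i j)
    (fun _ => hX _ _) hτ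

lemma measurable_X₂_apply {τ : α → SplitMap m} {X : α → Matrix (Fin (2 * m)) (Fin p) ℝ}
    (hτ : Measurable τ) (hX : ∀ i j, Measurable fun a => X a i j) (i : Fin m) (j : Fin p) :
    Measurable fun a => X₂ (τ a) (X a) i j :=
  measurable_countable_param (f := fun (t : SplitMap m) a => X₂ t (X a) i j)
    (fun _ => hX _ _) hτ

lemma measurable_y₁ {τ : α → SplitMap m} {y : α → Fin (2 * m) → ℝ}
    (hτ : Measurable τ) (hy : Measurable y) : Measurable fun a => y₁ (τ a) (y a) :=
  measurable_countable_param (f := fun (t : SplitMap m) a => y₁ t (y a))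
    (fun _ => measurable_pi_iff.2 fun _ => measurable_pi_iff.1 hy _) hτ

lemma measurable_y₂ {τ : α → SplitMap m} {y : α → Fin (2 * m) → ℝ}
    (hτ : Measurable τ) (hy : Measurable y) : Measurable fun a => y₂ (τ a) (y a) :=
  measurable_countable_param (f := fun (t : SplitMap m) a => y₂ t (y a))
    (fun _ => measurable_pi_iff.2 fun _ => measurable_pi_iff.1 hy _) hτ

end Measurability

/-! ### Freezing one of two independent variables -/

section Independence

variable {Ω : Type*} [MeasurableSpace Ω] {P : Measure Ω}

/-- A bound on the probability of an event that holds for each frozen value of one of two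
independent variables holds for the event itself. -/
lemma measure_le_of_indepFun [IsProbabilityMeasure P] {α γ : Type*} [MeasurableSpace α]
    [MeasurableSpace γ] {U : Ω → α} {W : Ω → γ} (hUW : IndepFun U W P) (hU : AEMeasurable U P)
    (hW : AEMeasurable W P) {B : Set (α × γ)} (hB : MeasurableSet B) {c : ENNReal}
    (h : ∀ w, P {ω | (U ω, w) ∈ B} ≤ c) : P {ω | (U ω, W ω) ∈ B} ≤ c := by
  have := Measure.isProbabilityMeasure_map hU (μ := P)
  have := Measure.isProbabilityMeasure_map hW (μ := P)
  have h1 : P {ω | (U ω, W ω) ∈ B} = P.map (fun ω => (U ω, W ω)) B :=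
    (Measure.map_apply_of_aemeasurable (hU.prodMk hW) hB).symm
  rw [h1, hUW.map_prod_eq_prod_map_map hU hW, Measure.prod_apply_symm hB]
  calc ∫⁻ w, P.map U ((fun u => (u, w)) ⁻¹' B) ∂(P.map W)
      ≤ ∫⁻ _, c ∂(P.map W) := lintegral_mono fun w => by
        rw [Measure.map_apply_of_aemeasurable hU (measurable_prodMk_right hB)]
        exact h w
    _ = c := by simp

lemma indepFun_comp_sum {ι κ : Type*} [Fintype ι] [Fintype κ] {e : ι ⊕ κ → Ω → ℝ}
    (he : iIndepFun e P) (hm : ∀ i, AEMeasurable (e i) P) :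
    IndepFun (fun ω i => e (Sum.inr i) ω) (fun ω i => e (Sum.inl i) ω) P := by
  classical
  have h := he.indepFun_finset₀ (Finset.univ.map Function.Embedding.inr)
    (Finset.univ.map Function.Embedding.inl)
    (by rw [Finset.disjoint_left]; intro x; simp only [Finset.mem_map]; rintro ⟨a, -, rfl⟩; simp) hm
  exact h.comp
    (φ := fun x (i : κ) => x ⟨Sum.inr i, Finset.mem_map_of_mem _ (Finset.mem_univ i)⟩)
    (ψ := fun x (i : ι) => x ⟨Sum.inl i, Finset.mem_map_of_mem _ (Finset.mem_univ i)⟩)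
    (measurable_pi_iff.2 fun _ => measurable_pi_apply _)
    (measurable_pi_iff.2 fun _ => measurable_pi_apply _)

end Independence

/-! ### Probability of a large quadratic form after refitting -/

section Refit

variable {m p : ℕ}

/-- The model selected from a design `X₁` and a noise `e₁` is nonsingular for the design `X₂`, has
at most `b` elements, and its centred projection gives a quadratic form in `e₂` of size at least
`δ`. -/
def LargeRefit (sel : Selector m p) (β : Fin p → ℝ) (b δ : ℝ)
    (X₁ X₂ : Matrix (Fin m) (Fin p) ℝ) (e₁ e₂ : Fin m → ℝ) : Prop :=
  (gram X₂ (sel X₁ (response X₁ β e₁))).det ≠ 0 ∧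
    ((sel X₁ (response X₁ β e₁)).card : ℝ) ≤ b ∧
    δ ≤ |e₂ ⬝ᵥ (centredProj X₂ (sel X₁ (response X₁ β e₁)) *ᵥ e₂)|

lemma measurableSet_largeRefit {α : Type*} [MeasurableSpace α] {sel : Selector m p}
    (hsel : ∀ N : Finset (Fin p), MeasurableSet
      {d : (Fin m → Fin p → ℝ) × (Fin m → ℝ) | sel (Matrix.of d.1) d.2 = N})
    (β : Fin p → ℝ) (b δ : ℝ) {Z₁ Z₂ : α → Matrix (Fin m) (Fin p) ℝ} {e₁ e₂ : α → Fin m → ℝ}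
    (hZ₁ : ∀ i j, Measurable fun a => Z₁ a i j) (hZ₂ : ∀ i j, Measurable fun a => Z₂ a i j)
    (he₁ : Measurable e₁) (he₂ : Measurable e₂) :
    MeasurableSet {a | LargeRefit sel β b δ (Z₁ a) (Z₂ a) (e₁ a) (e₂ a)} := by
  have hM := measurable_selector hsel hZ₁ (measurable_response hZ₁ β he₁)
  refine MeasurableSet.inter ?_ (MeasurableSet.inter ?_ ?_)
  · exact (measurable_det_gram hZ₂ hM) (measurableSet_singleton (0 : ℝ)).compl
  · exact measurableSet_le (measurable_card hM) measurable_const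
  · exact measurableSet_le measurable_const
      (measurable_dotProduct_mulVec (measurable_centredProj_apply hZ₂ hM) he₂).abs

variable {Ω : Type*} [MeasurableSpace Ω] {P : Measure Ω} [IsProbabilityMeasure P] {v V : ℝ}

/-- Trace zero makes the form equal to its centred version, and the squared Frobenius norm is at
most `M.card ≤ b`. -/
lemma measure_quadForm_centredProj_le {e : Fin m → Ω → ℝ} (hm : m ≠ 0) (hind : iIndepFun e P)
    (hL4 : ∀ i, MemLp (e i) 4 P) (hmean : ∀ i, ∫ ω, e i ω ∂P = 0)
    (hsq : ∀ i, ∫ ω, e i ω ^ 2 ∂P = v) (hV : ∀ i, ∫ ω, (e i ω ^ 2 - v) ^ 2 ∂P = V)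
    {Z : Matrix (Fin m) (Fin p) ℝ} {M : Finset (Fin p)} {b δ : ℝ} (hδ : 0 < δ)
    (hdet : (gram Z M).det ≠ 0) (hM : (M.card : ℝ) ≤ b) :
    P {ω | δ ≤ |(fun i => e i ω) ⬝ᵥ (centredProj Z M *ᵥ fun i => e i ω)|}
      ≤ ENNReal.ofReal ((V + 2 * v ^ 2) * b / δ ^ 2) := by
  have hA : ∀ i j, centredProj Z M i j = centredProj Z M j i := fun i j =>
    congrFun (congrFun (centredProj_transpose Z M) j) i
  have htr : ∑ i, centredProj Z M i i = 0 := trace_centredProj hm hdet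
  have hq : ∀ x : Fin m → ℝ, x ⬝ᵥ (centredProj Z M *ᵥ x)
      = centredQuadForm (centredProj Z M) v Finset.univ x := by
    intro x
    simp only [centredQuadForm, htr, mul_zero, sub_zero, dotProduct, Matrix.mulVec, Finset.mul_sum]
    exact Finset.sum_congr rfl fun i _ => Finset.sum_congr rfl fun j _ => by ring
  simp only [hq]
  refine (measure_abs_centredQuadForm_ge_le hind hL4 hmean hsq hV hA _ hδ).trans
    (ENNReal.ofReal_le_ofReal ?_)
  have hV0 : 0 ≤ V := hV ⟨0, Nat.pos_of_ne_zero hm⟩ ▸ integral_nonneg fun ω => sq_nonneg _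
  have := (sum_sq_centredProj_le hm hdet).trans hM
  gcongr

/-- Since the model is selected on one group and refitted on the other one, the quadratic form
that measures the refitting error has a second moment bounded by the size of the model. -/
lemma measure_largeRefit_le (hm : m ≠ 0) {sel : Selector m p}
    (hsel : ∀ N : Finset (Fin p), MeasurableSet
      {d : (Fin m → Fin p → ℝ) × (Fin m → ℝ) | sel (Matrix.of d.1) d.2 = N})
    (β : Fin p → ℝ) {X : Ω → Matrix (Fin (2 * m)) (Fin p) ℝ}
    (hX : ∀ i j, Measurable fun ω => X ω i j) {τ : Ω → SplitMap m} (hτ : Measurable τ)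
    (hbij : ∀ ω, Function.Bijective (τ ω)) {e : Fin (2 * m) → Ω → ℝ}
    (hnoise : IndepFun (fun ω i => e i ω)
      (fun ω => ((fun i j => X ω i j : Fin (2 * m) → Fin p → ℝ), τ ω)) P)
    (hind : iIndepFun e P)
    (hL4 : ∀ i, MemLp (e i) 4 P) (hmean : ∀ i, ∫ ω, e i ω ∂P = 0)
    (hsq : ∀ i, ∫ ω, e i ω ^ 2 ∂P = v) (hV : ∀ i, ∫ ω, (e i ω ^ 2 - v) ^ 2 ∂P = V)
    (b : ℝ) {δ : ℝ} (hδ : 0 < δ) :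
    P {ω | LargeRefit sel β b δ (X₁ (τ ω) (X ω)) (X₂ (τ ω) (X ω)) (y₁ (τ ω) fun i => e i ω)
      (y₂ (τ ω) fun i => e i ω)} ≤ ENNReal.ofReal ((V + 2 * v ^ 2) * b / δ ^ 2) := by
  have hem : ∀ i, AEMeasurable (e i) P := fun i => (hL4 i).aemeasurable
  have hD : Measurable fun ω => ((fun i j => X ω i j : Fin (2 * m) → Fin p → ℝ), τ ω) :=
    (measurable_pi_iff.2 fun i => measurable_pi_iff.2 fun j => hX i j).prodMk hτ
  -- Bijectivity is part of the event because the bound must hold for every frozen split, and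
  -- injectivity is what keeps the relabelled noise independent.
  let B : Set ((Fin (2 * m) → ℝ) × ((Fin (2 * m) → Fin p → ℝ) × SplitMap m)) :=
    {q | Function.Bijective q.2.2 ∧ LargeRefit sel β b δ (X₁ q.2.2 (Matrix.of q.2.1))
      (X₂ q.2.2 (Matrix.of q.2.1)) (y₁ q.2.2 q.1) (y₂ q.2.2 q.1)}
  have hB : MeasurableSet B := by
    have ht : Measurable fun q : (Fin (2 * m) → ℝ) × ((Fin (2 * m) → Fin p → ℝ) × SplitMap m) =>
      q.2.2 := by fun_prop
    have hx : ∀ i j, Measurable fun q : (Fin (2 * m) → ℝ) ×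
        ((Fin (2 * m) → Fin p → ℝ) × SplitMap m) => Matrix.of q.2.1 i j := fun i j => by
      simp only [Matrix.of_apply]; fun_prop
    exact (ht (Set.to_countable {t | Function.Bijective t}).measurableSet).inter
      (measurableSet_largeRefit hsel β b δ (measurable_X₁_apply ht hx) (measurable_X₂_apply ht hx)
        (measurable_y₁ ht measurable_fst) (measurable_y₂ ht measurable_fst))
  have key : ∀ w, P {ω | ((fun i => e i ω), w) ∈ B}
      ≤ ENNReal.ofReal ((V + 2 * v ^ 2) * b / δ ^ 2) := by
    rintro ⟨x, t⟩
    by_cases ht : Function.Bijective t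
    swap
    · have : {ω | ((fun i => e i ω), x, t) ∈ B} = ∅ :=
        Set.eq_empty_of_forall_notMem fun ω hω => ht hω.1
      rw [this]
      simp
    have hind' : iIndepFun (fun i => e (t i)) P := hind.precomp ht.injective
    have hI := indepFun_comp_sum hind' fun i => hem _
    -- Second freezing: the noise of the first group, `q.2`, determines the model, and only that of
    -- the second group, `q.1`, stays random.
    let B' : Set ((Fin m → ℝ) × (Fin m → ℝ)) :=
      {q | LargeRefit sel β b δ (X₁ t (Matrix.of x)) (X₂ t (Matrix.of x)) q.2 q.1}
    have hB' : MeasurableSet B' :=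
      measurableSet_largeRefit hsel β b δ (fun _ _ => measurable_const)
        (fun _ _ => measurable_const) measurable_snd measurable_fst
    have key' : ∀ w, P {ω | ((fun i => e (t (Sum.inr i)) ω), w) ∈ B'}
        ≤ ENNReal.ofReal ((V + 2 * v ^ 2) * b / δ ^ 2) := by
      intro w
      -- `LargeRefit` includes nonsingularity and the size bound, so the event is empty for the
      -- frozen values where Chebyshev's bound is unavailable.
      by_cases h : (gram (X₂ t (Matrix.of x)) (sel (X₁ t (Matrix.of x))
          (response (X₁ t (Matrix.of x)) β w))).det ≠ 0 ∧
          ((sel (X₁ t (Matrix.of x)) (response (X₁ t (Matrix.of x)) β w)).card : ℝ) ≤ b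
      · refine (measure_mono ?_).trans (measure_quadForm_centredProj_le hm
          (e := fun i => e (t (Sum.inr i))) (hind'.precomp Sum.inr_injective) (fun i => hL4 _)
          (fun i => hmean _) (fun i => hsq _) (fun i => hV _) hδ h.1 h.2)
        exact fun ω hω => hω.2.2
      · have : {ω | ((fun i => e (t (Sum.inr i)) ω), w) ∈ B'} = ∅ :=
          Set.eq_empty_of_forall_notMem fun ω hω => h ⟨hω.1, hω.2.1⟩
        rw [this]
        simp
    refine (measure_mono ?_).trans (measure_le_of_indepFun hI
      (aemeasurable_pi_iff.2 fun i => hem _) (aemeasurable_pi_iff.2 fun i => hem _) hB' key')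
    exact fun ω hω => hω.2
  refine (measure_mono ?_).trans
    (measure_le_of_indepFun hnoise (aemeasurable_pi_iff.2 hem) hD.aemeasurable hB key)
  exact fun ω hω => ⟨hbij ω, hω⟩

end Refit

/-! ### The scaled refitting error -/

section RefitError

variable {m p : ℕ}

/-- Half of the scaled difference between the variance estimator refitted on the second group and
the mean of the squared noise of that group. -/
noncomputable def refitError (sel : Selector m p) (β : Fin p → ℝ) (τ : SplitMap m)
    (X : Matrix (Fin (2 * m)) (Fin p) ℝ) (e : Fin (2 * m) → ℝ) : ℝ :=
  √((2 * m : ℕ) : ℝ) * (olsVariance (X₂ τ X) (y₂ τ (response X β e)) (M₁ sel τ X (response X β e))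
    - (y₂ τ e ⬝ᵥ y₂ τ e) / m) / 2

lemma measurable_M₁ {α : Type*} [MeasurableSpace α] {sel : Selector m p}
    (hsel : ∀ N : Finset (Fin p), MeasurableSet
      {d : (Fin m → Fin p → ℝ) × (Fin m → ℝ) | sel (Matrix.of d.1) d.2 = N})
    {X : α → Matrix (Fin (2 * m)) (Fin p) ℝ} (hX : ∀ i j, Measurable fun a => X a i j)
    {τ : α → SplitMap m} (hτ : Measurable τ) {y : α → Fin (2 * m) → ℝ} (hy : Measurable y) :
    Measurable fun a => M₁ sel (τ a) (X a) (y a) :=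
  measurable_selector hsel (measurable_X₁_apply hτ hX) (measurable_y₁ hτ hy)

lemma measurable_refitError {α : Type*} [MeasurableSpace α] {sel : Selector m p}
    (hsel : ∀ N : Finset (Fin p), MeasurableSet
      {d : (Fin m → Fin p → ℝ) × (Fin m → ℝ) | sel (Matrix.of d.1) d.2 = N}) (β : Fin p → ℝ)
    {X : α → Matrix (Fin (2 * m)) (Fin p) ℝ} (hX : ∀ i j, Measurable fun a => X a i j)
    {τ : α → SplitMap m} (hτ : Measurable τ) {e : α → Fin (2 * m) → ℝ} (he : Measurable e) :
    Measurable fun a => refitError sel β (τ a) (X a) (e a) := by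
  have hy := measurable_response hX β he
  have h2 := measurable_pi_iff.1 (measurable_y₂ hτ he)
  refine ((measurable_const.mul ((measurable_olsVariance (measurable_X₂_apply hτ hX)
    (measurable_y₂ hτ hy) (measurable_M₁ hsel hX hτ hy)).sub
      (Measurable.div_const ?_ _))).div_const _)
  exact Finset.measurable_fun_sum _ fun i _ => (h2 i).mul (h2 i)

/-- Since `k ≤ b ≤ m/2`, the denominator satisfies `2(m - k) ≥ m`; the factor `2` is the one from
averaging the two estimators. -/
lemma abs_refitError_le {sel : Selector m p} {β : Fin p → ℝ} {τ : SplitMap m}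
    {X : Matrix (Fin (2 * m)) (Fin p) ℝ} {e : Fin (2 * m) → ℝ} {b : ℝ} (hm : m ≠ 0)
    (hdet : (gram (X₂ τ X) (M₁ sel τ X (response X β e))).det ≠ 0)
    (hscreen : trueModel β ⊆ M₁ sel τ X (response X β e))
    (hsize : ((M₁ sel τ X (response X β e)).card : ℝ) ≤ b) (hb : b ≤ m / 2) :
    |refitError sel β τ X e| ≤ √((2 * m : ℕ) : ℝ) / m *
      |y₂ τ e ⬝ᵥ (centredProj (X₂ τ X) (M₁ sel τ X (response X β e)) *ᵥ y₂ τ e)| := by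
  have hm' : (0 : ℝ) < m := by exact_mod_cast Nat.pos_of_ne_zero hm
  have hr : y₂ τ (response X β e) = response (X₂ τ X) β (y₂ τ e) := rfl
  have h := olsVariance_response_sub hm (y₂ τ e) hdet hscreen (by linarith)
  rw [refitError, hr, h]
  set k : ℝ := ((M₁ sel τ X (response X β e)).card : ℝ)
  set q := y₂ τ e ⬝ᵥ (centredProj (X₂ τ X) (M₁ sel τ X (response X β e)) *ᵥ y₂ τ e)
  have hk : 0 < (m : ℝ) - k := by linarith
  rw [abs_div, abs_mul, abs_div, abs_of_pos hk, abs_of_nonneg (Real.sqrt_nonneg _),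
    abs_of_pos (two_pos : (0 : ℝ) < 2), div_mul_eq_mul_div, mul_div_assoc, mul_div_assoc]
  refine mul_le_mul_of_nonneg_left ?_ (Real.sqrt_nonneg _)
  rw [div_div]
  exact div_le_div_of_nonneg_left (abs_nonneg _) hm' (by linarith)

end RefitError

/-! ### Negligibility of the refitting error and the central limit theorem -/

section Asymptotics

variable {Ω : Type*} [MeasurableSpace Ω] {P : Measure Ω}

/-- Only the larger sets need be null measurable. This allows the eigenvalue event to be replaced by
the nonvanishing of finitely many determinants. -/
lemma tendsto_measure_compl_of_subset [IsProbabilityMeasure P] {s u : ℕ → Set Ω}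
    (hs : Tendsto (fun m => P (s m)) atTop (𝓝 1)) (hsu : ∀ m, s m ⊆ u m)
    (hu : ∀ m, NullMeasurableSet (u m) P) : Tendsto (fun m => P (u m)ᶜ) atTop (𝓝 0) := by
  have h1 : Tendsto (fun m => P (u m)) atTop (𝓝 1) :=
    tendsto_of_tendsto_of_tendsto_of_le_of_le hs tendsto_const_nhds
      (fun m => measure_mono (hsu m)) fun m => prob_le_one
  have h2 := ENNReal.Tendsto.sub (tendsto_const_nhds (x := (1 : ENNReal)) (f := atTop)) h1
    (Or.inl ENNReal.one_ne_top)
  simp only [tsub_self] at h2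
  exact h2.congr fun m => (prob_compl_eq_one_sub₀ (hu m)).symm

/-- A measurable function of design, split and noise is almost everywhere measurable. -/
lemma aemeasurable_of_noise {γ : Type*} [MeasurableSpace γ] {m p : ℕ} {ε : ℕ → Ω → ℝ}
    (hε : ∀ i, AEMeasurable (ε i) P) {X : Ω → Matrix (Fin (2 * m)) (Fin p) ℝ}
    (hX : ∀ i j, Measurable fun ω => X ω i j) {τ : Ω → SplitMap m} (hτ : Measurable τ)
    {f : SplitMap m → Matrix (Fin (2 * m)) (Fin p) ℝ → (Fin (2 * m) → ℝ) → γ}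
    (hf : Measurable fun q : (Fin (2 * m) → ℝ) × ((Fin (2 * m) → Fin p → ℝ) × SplitMap m) =>
      f q.2.2 (Matrix.of q.2.1) q.1) :
    AEMeasurable (fun ω => f (τ ω) (X ω) fun i => ε i ω) P := by
  have hD : Measurable fun ω => ((fun i j => X ω i j : Fin (2 * m) → Fin p → ℝ), τ ω) :=
    (measurable_pi_iff.2 fun i => measurable_pi_iff.2 fun j => hX i j).prodMk hτ
  have he : AEMeasurable (fun ω (i : Fin (2 * m)) => ε i ω) P := aemeasurable_pi_iff.2 fun i => hε i
  exact hf.comp_aemeasurable (he.prodMk hD.aemeasurable)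

lemma measurable_of_design_apply {α : Type*} [MeasurableSpace α] {m p : ℕ} (i : Fin m)
    (j : Fin p) : Measurable fun q : (Fin m → ℝ) × ((Fin m → Fin p → ℝ) × α) =>
      Matrix.of q.2.1 i j := by
  simp only [Matrix.of_apply]
  fun_prop

lemma aemeasurable_refitError {m p : ℕ} {ε : ℕ → Ω → ℝ}
    (hε : ∀ i, AEMeasurable (ε i) P) {X : Ω → Matrix (Fin (2 * m)) (Fin p) ℝ}
    (hX : ∀ i j, Measurable fun ω => X ω i j) {τ : Ω → SplitMap m} (hτ : Measurable τ)
    {sel : Selector m p} (hsel : ∀ N : Finset (Fin p), MeasurableSet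
      {d : (Fin m → Fin p → ℝ) × (Fin m → ℝ) | sel (Matrix.of d.1) d.2 = N})
    (β : Fin p → ℝ) :
    AEMeasurable (fun ω => refitError sel β (τ ω) (X ω) fun i => ε i ω) P :=
  aemeasurable_of_noise hε hX hτ (f := fun t x e => refitError sel β t x e)
    (measurable_refitError hsel β measurable_of_design_apply (by fun_prop) measurable_fst)

lemma nullMeasurableSet_screening {m p : ℕ} {ε : ℕ → Ω → ℝ}
    (hε : ∀ i, AEMeasurable (ε i) P) {X : Ω → Matrix (Fin (2 * m)) (Fin p) ℝ}
    (hX : ∀ i j, Measurable fun ω => X ω i j) {τ : Ω → SplitMap m} (hτ : Measurable τ)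
    {sel : Selector m p} (hsel : ∀ N : Finset (Fin p), MeasurableSet
      {d : (Fin m → Fin p → ℝ) × (Fin m → ℝ) | sel (Matrix.of d.1) d.2 = N})
    (β : Fin p → ℝ) :
    NullMeasurableSet {ω | trueModel β ⊆
      M₁ sel (τ ω) (X ω) (response (X ω) β fun i => ε i ω)} P := by
  have h : AEMeasurable (fun ω => M₁ sel (τ ω) (X ω) (response (X ω) β fun i => ε i ω)) P :=
    aemeasurable_of_noise hε hX hτ (f := fun t x e => M₁ sel t x (response x β e))
      (measurable_M₁ hsel measurable_of_design_apply (by fun_prop)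
        (measurable_response measurable_of_design_apply β measurable_fst))
  exact h.nullMeasurableSet_preimage (Set.to_countable {N | trueModel β ⊆ N}).measurableSet

/-- The refitting error is asymptotically negligible. -/
lemma tendstoInMeasure_refitError [IsProbabilityMeasure P] {ε : ℕ → Ω → ℝ} {v V : ℝ}
    (hind : iIndepFun ε P)
    (hL4 : ∀ i, MemLp (ε i) 4 P) (hmean : ∀ i, ∫ ω, ε i ω ∂P = 0)
    (hsq : ∀ i, ∫ ω, ε i ω ^ 2 ∂P = v) (hV : ∀ i, ∫ ω, (ε i ω ^ 2 - v) ^ 2 ∂P = V)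
    {p : ℕ → ℕ} {β : ∀ m, Fin (p m) → ℝ} {X : ∀ m, Ω → Matrix (Fin (2 * m)) (Fin (p m)) ℝ}
    (hX : ∀ m i j, Measurable fun ω => X m ω i j) {τ : ∀ m, Ω → SplitMap m}
    (hτ : ∀ m, Measurable (τ m)) (hbij : ∀ m ω, Function.Bijective (τ m ω))
    (hnoise : ∀ m, IndepFun (fun ω (i : Fin (2 * m)) => ε i ω)
      (fun ω => ((fun i j => X m ω i j : Fin (2 * m) → Fin (p m) → ℝ), τ m ω)) P)
    {b : ℕ → ℝ} (hb : Tendsto (fun m : ℕ => b m / ((2 * m : ℕ) : ℝ)) atTop (𝓝 0))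
    {lam : ℝ} (hlam : 0 < lam)
    (heig : Tendsto (fun m => P {ω | (lam : EReal) ≤ phiMin (X₂ (τ m ω) (X m ω)) (b m)})
      atTop (𝓝 1))
    {sel : ∀ m, Selector m (p m)}
    (hsel : ∀ m (N : Finset (Fin (p m))), MeasurableSet
      {d : (Fin m → Fin (p m) → ℝ) × (Fin m → ℝ) | sel m (Matrix.of d.1) d.2 = N})
    (hscreen : Tendsto (fun m => P {ω | trueModel (β m) ⊆
      M₁ (sel m) (τ m ω) (X m ω) (response (X m ω) (β m) fun i => ε i ω)}) atTop (𝓝 1))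
    (hsize : ∀ m, ∀ᵐ ω ∂P, ((M₁ (sel m) (τ m ω) (X m ω)
      (response (X m ω) (β m) fun i => ε i ω)).card : ℝ) ≤ b m) :
    TendstoInMeasure P (fun m ω => refitError (sel m) (β m) (τ m ω) (X m ω) fun i => ε i ω)
      atTop (fun _ => 0) := by
  have hem : ∀ i, AEMeasurable (ε i) P := fun i => (hL4 i).aemeasurable
  let F : ℕ → Set Ω := fun m => {ω | ∀ N : Finset (Fin (p m)), (N.card : ℝ) ≤ b m →
    (gram (X₂ (τ m ω) (X m ω)) N).det ≠ 0}
  let S : ℕ → Set Ω := fun m => {ω | trueModel (β m) ⊆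
      M₁ (sel m) (τ m ω) (X m ω) (response (X m ω) (β m) fun i => ε i ω)}
  have hF : Tendsto (fun m => P (F m)ᶜ) atTop (𝓝 0) := by
    refine tendsto_measure_compl_of_subset heig
      (fun m ω hω N hN => det_gram_ne_zero_of_phiMin hlam hω hN) fun m => ?_
    have : F m = ⋂ N : Finset (Fin (p m)), ⋂ _ : (N.card : ℝ) ≤ b m,
        {ω | (gram (X₂ (τ m ω) (X m ω)) N).det ≠ 0} := by
      ext ω
      simp [F]
    rw [this]
    refine (MeasurableSet.iInter fun N => MeasurableSet.iInter fun _ => ?_).nullMeasurableSet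
    exact (measurable_det_gram (measurable_X₂_apply (hτ m) (hX m)) measurable_const)
      (measurableSet_singleton (0 : ℝ)).compl
  have hS : Tendsto (fun m => P (S m)ᶜ) atTop (𝓝 0) :=
    tendsto_measure_compl_of_subset hscreen (fun m => subset_rfl)
      fun m => nullMeasurableSet_screening hem (hX m) (hτ m) (hsel m) (β m)
  rw [tendstoInMeasure_iff_norm]
  intro δ hδ
  simp only [sub_zero, Real.norm_eq_abs]
  have hC : Tendsto (fun m : ℕ => ENNReal.ofReal (4 * (V + 2 * v ^ 2) / δ ^ 2 *
      (b m / ((2 * m : ℕ) : ℝ)))) atTop (𝓝 0) := by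
    have := ENNReal.tendsto_ofReal (hb.const_mul (4 * (V + 2 * v ^ 2) / δ ^ 2))
    simpa using this
  have hsum := (hF.add hS).add hC
  simp only [add_zero] at hsum
  refine tendsto_of_tendsto_of_tendsto_of_le_of_le' tendsto_const_nhds hsum
    (Eventually.of_forall fun _ => zero_le) ?_
  filter_upwards [hb.eventually_le_const (by norm_num : (0 : ℝ) < 1 / 4), eventually_ne_atTop 0]
    with m hbm hm
  have hm' : (0 : ℝ) < m := by exact_mod_cast Nat.pos_of_ne_zero hm
  have hbm' : b m ≤ m / 2 := by
    rw [div_le_iff₀ (by positivity)] at hbm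
    push_cast at hbm
    linarith
  have hs : 0 < √((2 * m : ℕ) : ℝ) := Real.sqrt_pos.2 (by positivity)
  -- By `abs_refitError_le`, a refitting error of at least `δ` forces the quadratic form to be at
  -- least this threshold.
  have hδ' : 0 < δ * m / √((2 * m : ℕ) : ℝ) := by positivity
  have hL := measure_largeRefit_le hm (hsel m) (β m) (hX m) (hτ m) (hbij m)
    (e := fun i : Fin (2 * m) => ε i) (hnoise m) (hind.precomp Fin.val_injective)
    (fun i => hL4 i) (fun i => hmean i) (fun i => hsq i) (fun i => hV i) (b m) hδ'
  have hval : (V + 2 * v ^ 2) * b m / (δ * m / √((2 * m : ℕ) : ℝ)) ^ 2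
      = 4 * (V + 2 * v ^ 2) / δ ^ 2 * (b m / ((2 * m : ℕ) : ℝ)) := by
    rw [div_pow, Real.sq_sqrt (by positivity)]
    push_cast
    field_simp
    ring
  rw [hval] at hL
  refine le_trans ?_ (add_le_add_right hL _)
  refine le_trans ?_ ((add_le_add_left (measure_union_le _ _) _).trans' (measure_union_le _ _))
  -- Outside a null set, a large error means a singular Gram matrix, failed screening or
  -- `LargeRefit`.
  refine measure_mono_ae ?_
  filter_upwards [hsize m] with ω hω hge
  by_cases h1 : ω ∈ F m
  swap
  · exact Or.inl (Or.inl h1)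
  by_cases h2 : ω ∈ S m
  swap
  · exact Or.inl (Or.inr h2)
  refine Or.inr ⟨h1 _ hω, hω, ?_⟩
  have hle := le_trans hge (abs_refitError_le hm (h1 _ hω) h2 hω hbm')
  rw [div_mul_eq_mul_div, le_div_iff₀ hm'] at hle
  rw [div_le_iff₀' hs]
  exact hle

/-- The scaled error of the refitted cross-validation estimator is that of the oracle estimator
up to the two refitting errors. -/
lemma sqrt_mul_rcv_sub {m p : ℕ} (sel : Selector m p) (β : Fin p → ℝ) {τ : SplitMap m}
    (hτ : Function.Bijective τ) (X : Matrix (Fin (2 * m)) (Fin p) ℝ) (e : Fin (2 * m) → ℝ)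
    (s : ℝ) :
    √((2 * m : ℕ) : ℝ) * (rcv sel τ X (response X β e) - s)
      = (√((2 * m : ℕ) : ℝ))⁻¹ * (∑ i, e i ^ 2 - ((2 * m : ℕ) : ℝ) * s)
        + refitError sel β τ X e + refitError sel β (τ ∘ Sum.swap) X e := by
  rcases eq_or_ne m 0 with rfl | hm
  · simp [refitError]
  have hm' : (0 : ℝ) < m := by exact_mod_cast Nat.pos_of_ne_zero hm
  have hs : 0 < √((2 * m : ℕ) : ℝ) := Real.sqrt_pos.2 (by positivity)
  have hsum : ∑ i, e i ^ 2 = y₂ τ e ⬝ᵥ y₂ τ e + y₁ τ e ⬝ᵥ y₁ τ e := by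
    rw [← hτ.sum_comp fun i => e i ^ 2, Fintype.sum_sum_type, add_comm]
    simp [y₁, y₂, dotProduct, pow_two]
  -- Composing the split with `Sum.swap` exchanges the two groups, so one notion of error serves
  -- both estimators.
  have h1 : refitError sel β (τ ∘ Sum.swap) X e = √((2 * m : ℕ) : ℝ) *
      (olsVariance (X₁ τ X) (y₁ τ (response X β e)) (M₂ sel τ X (response X β e))
        - (y₁ τ e ⬝ᵥ y₁ τ e) / m) / 2 := rfl
  have hinv : (√((2 * m : ℕ) : ℝ))⁻¹ = √((2 * m : ℕ) : ℝ) / (2 * m) := by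
    rw [inv_eq_one_div, div_eq_div_iff hs.ne' (by positivity), Real.mul_self_sqrt (by positivity)]
    push_cast
    ring
  rw [h1, refitError, rcv, hsum, hinv]
  push_cast
  field_simp
  ring

lemma sqrt_mul_oracle_sub {n p : ℕ} (β : Fin p → ℝ) (X : Matrix (Fin n) (Fin p) ℝ)
    (e : Fin n → ℝ) (s : ℝ) :
    √(n : ℝ) * (oracle β X (response X β e) - s) = (√(n : ℝ))⁻¹ * (∑ i, e i ^ 2 - n * s) := by
  rcases eq_or_ne n 0 with rfl | hn
  · simp
  have hn' : (0 : ℝ) < n := by exact_mod_cast Nat.pos_of_ne_zero hn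
  have hs : 0 < √(n : ℝ) := Real.sqrt_pos.2 hn'
  have hr : ∀ i, response X β e i - X i ⬝ᵥ β = e i := fun i => by
    simp [response, Matrix.mulVec]
  simp only [oracle, hr]
  have hinv : (√(n : ℝ))⁻¹ = √(n : ℝ) / n := by
    rw [inv_eq_one_div, div_eq_div_iff hs.ne' hn'.ne', Real.mul_self_sqrt hn'.le, one_mul]
  rw [hinv]
  field_simp

/-- The central limit theorem for the squares of the noise, along the even sample sizes. -/
lemma tendstoInDistribution_sum_sq [IsProbabilityMeasure P] {ε : ℕ → Ω → ℝ} {v : ℝ}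
    (hind : iIndepFun ε P) (hident : ∀ i, IdentDistrib (ε i) (ε 0) P P)
    (hL4 : MemLp (ε 0) 4 P) (hsq : ∫ ω, ε 0 ω ^ 2 ∂P = v) :
    TendstoInDistribution (fun (m : ℕ) ω => (√((2 * m : ℕ) : ℝ))⁻¹ *
        (∑ i : Fin (2 * m), ε i ω ^ 2 - ((2 * m : ℕ) : ℝ) * v)) atTop (id : ℝ → ℝ) (fun _ => P)
      (gaussianReal 0 (∫ ω, ε 0 ω ^ 4 ∂P - v ^ 2).toNNReal) := by
  have hL2 : MemLp (fun ω => ε 0 ω ^ 2) 2 P := by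
    simpa using memLp_sq_sub_const hL4 0
  -- This identifies the limiting variance and shows that `toNNReal` truncates nothing.
  have hvar : Var[fun ω => ε 0 ω ^ 2; P] = ∫ ω, ε 0 ω ^ 4 ∂P - v ^ 2 := by
    rw [variance_eq_sub hL2, hsq]
    congr 1
    exact integral_congr_ae (ae_of_all _ fun ω => by simp only [Pi.pow_apply]; ring)
  have h := tendstoInDistribution_inv_sqrt_mul_sum_sub (X := fun i ω => ε i ω ^ 2) (Y := id)
    (P := P) (P' := gaussianReal 0 (∫ ω, ε 0 ω ^ 4 ∂P - v ^ 2).toNNReal)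
    (by rw [hvar]; exact HasLaw.id) hL2
    (hind.comp (fun _ x => x ^ 2) fun _ => by fun_prop)
    (fun i => (hident i).comp (u := fun x => x ^ 2) (by fun_prop))
  rw [hsq] at h
  have h2 : Tendsto (fun m : ℕ => 2 * m) atTop atTop :=
    tendsto_id.const_mul_atTop' two_pos
  have h' : TendstoInDistribution (fun (m : ℕ) ω => (√((2 * m : ℕ) : ℝ))⁻¹ *
      (∑ i ∈ Finset.range (2 * m), ε i ω ^ 2 - ((2 * m : ℕ) : ℝ) * v)) atTop (id : ℝ → ℝ)
      (fun _ => P) (gaussianReal 0 (∫ ω, ε 0 ω ^ 4 ∂P - v ^ 2).toNNReal) :=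
    ⟨fun m => h.forall_aemeasurable (2 * m), h.aemeasurable_limit, h.tendsto.comp h2⟩
  simpa only [Finset.sum_range] using h'

end Asymptotics

end RefittedCV

/-! ### Assembly by Slutsky's theorem -/

theorem theorem2
    {Ω : Type*} [MeasurableSpace Ω] (P : Measure Ω) [IsProbabilityMeasure P]
    -- the noise: i.i.d., centred, variance `σ ^ 2`, finite fourth moment
    (ε : ℕ → Ω → ℝ) (σ : ℝ)
    (hindep : iIndepFun ε P)
    (hident : ∀ i, IdentDistrib (ε i) (ε 0) P P)
    (hmean : ∫ ω, ε 0 ω ∂P = 0)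
    (hvar : Var[ε 0; P] = σ ^ 2)
    (hfourth : MemLp (ε 0) 4 P)
    -- for every `m`: coefficients, design and split of a sample of size `n = 2 * m`
    (p : ℕ → ℕ) (β : ∀ m, Fin (p m) → ℝ)
    (X : ∀ m, Ω → Matrix (Fin (2 * m)) (Fin (p m)) ℝ) (hX : ∀ m i j, Measurable fun ω => X m ω i j)
    (τ : ∀ m, Ω → RefittedCV.SplitMap m) (hτ : ∀ m, Measurable (τ m))
    (hτbij : ∀ m ω, Function.Bijective (τ m ω))
    -- the noise is independent of the design and of the split
    (hnoise : ∀ m, IndepFun (fun ω (i : Fin (2 * m)) => ε i ω)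
      (fun ω => ((fun i j => X m ω i j : Fin (2 * m) → Fin (p m) → ℝ), τ m ω)) P)
    -- the responses
    (Y : ∀ m, Ω → Fin (2 * m) → ℝ)
    (hY : ∀ m ω, Y m ω = RefittedCV.response (X m ω) (β m) (fun i => ε i ω))
    -- sparse eigenvalue condition on the design matrix of each group
    (b : ℕ → ℝ) (hb : Tendsto (fun m : ℕ => b m / ((2 * m : ℕ) : ℝ)) atTop (𝓝 0))
    (lam0 : ℝ) (hlam0 : 0 < lam0)
    (heig₁ : Tendsto (fun m => P {ω | (lam0 : EReal) ≤
      RefittedCV.phiMin (RefittedCV.X₁ (τ m ω) (X m ω)) (b m)}) atTop (𝓝 1))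
    (heig₂ : Tendsto (fun m => P {ω | (lam0 : EReal) ≤
      RefittedCV.phiMin (RefittedCV.X₂ (τ m ω) (X m ω)) (b m)}) atTop (𝓝 1))
    -- the model selection procedure
    (sel : ∀ m, RefittedCV.Selector m (p m))
    (hsel : ∀ m (M : Finset (Fin (p m))), MeasurableSet
      {d : (Fin m → Fin (p m) → ℝ) × (Fin m → ℝ) | sel m (Matrix.of d.1) d.2 = M})
    -- sure screening on both groups
    (hscreen₁ : Tendsto (fun m => P {ω | RefittedCV.trueModel (β m) ⊆
      RefittedCV.M₁ (sel m) (τ m ω) (X m ω) (Y m ω)}) atTop (𝓝 1))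
    (hscreen₂ : Tendsto (fun m => P {ω | RefittedCV.trueModel (β m) ⊆
      RefittedCV.M₂ (sel m) (τ m ω) (X m ω) (Y m ω)}) atTop (𝓝 1))
    -- selected model sizes
    (hsize₁ : ∀ m, ∀ᵐ ω ∂P,
      ((RefittedCV.M₁ (sel m) (τ m ω) (X m ω) (Y m ω)).card : ℝ) ≤ b m)
    (hsize₂ : ∀ m, ∀ᵐ ω ∂P,
      ((RefittedCV.M₂ (sel m) (τ m ω) (X m ω) (Y m ω)).card : ℝ) ≤ b m) :
    TendstoInDistribution
      (fun (m : ℕ) ω => √((2 * m : ℕ) : ℝ) *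
        (RefittedCV.rcv (sel m) (τ m ω) (X m ω) (Y m ω) - σ ^ 2))
      atTop (id : ℝ → ℝ) (fun _ => P)
      (gaussianReal 0 (∫ ω, ε 0 ω ^ 4 ∂P - σ ^ 4).toNNReal) ∧
    TendstoInDistribution
      (fun (m : ℕ) ω => √((2 * m : ℕ) : ℝ) *
        (RefittedCV.oracle (β m) (X m ω) (Y m ω) - σ ^ 2))
      atTop (id : ℝ → ℝ) (fun _ => P)
      (gaussianReal 0 (∫ ω, ε 0 ω ^ 4 ∂P - σ ^ 4).toNNReal) := by
  have hid : ∀ i, MemLp (ε i) 4 P := fun i => (hident i).memLp_iff.2 hfourth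
  have hm : ∀ i, ∫ ω, ε i ω ∂P = 0 := fun i => (hident i).integral_eq.trans hmean
  have hsq0 : ∫ ω, ε 0 ω ^ 2 ∂P = σ ^ 2 := by
    rw [← variance_of_integral_eq_zero hfourth.aemeasurable hmean, hvar]
  have hsq : ∀ i, ∫ ω, ε i ω ^ 2 ∂P = σ ^ 2 := fun i =>
    (((hident i).comp (u := fun x => x ^ 2) (by fun_prop)).integral_eq).trans hsq0
  have hV : ∀ i, ∫ ω, (ε i ω ^ 2 - σ ^ 2) ^ 2 ∂P = ∫ ω, (ε 0 ω ^ 2 - σ ^ 2) ^ 2 ∂P := fun i =>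
    ((hident i).comp (u := fun x => (x ^ 2 - σ ^ 2) ^ 2) (by fun_prop)).integral_eq
  have hclt := RefittedCV.tendstoInDistribution_sum_sq hindep hident hfourth hsq0
  rw [← pow_mul] at hclt
  simp only [hY] at hscreen₁ hscreen₂ hsize₁ hsize₂ ⊢
  have hτ' : ∀ m, Measurable fun ω => τ m ω ∘ Sum.swap := fun m =>
    (measurable_of_countable fun t : RefittedCV.SplitMap m => t ∘ Sum.swap).comp (hτ m)
  have hswap : ∀ m, Measurable fun d : (Fin (2 * m) → Fin (p m) → ℝ) × RefittedCV.SplitMap m =>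
      (d.1, d.2 ∘ Sum.swap) := fun m => measurable_fst.prodMk
    ((measurable_of_countable fun t : RefittedCV.SplitMap m => t ∘ Sum.swap).comp measurable_snd)
  -- The model comes from the first group and the Gram matrix from the second, hence `heig₂`
  -- together with `hscreen₁`; the swapped split reverses the roles.
  have herr₁ := RefittedCV.tendstoInMeasure_refitError hindep hid hm hsq hV hX hτ hτbij hnoise hb
    hlam0 heig₂ hsel hscreen₁ hsize₁
  have herr₂ := RefittedCV.tendstoInMeasure_refitError hindep hid hm hsq hV hX hτ'
    (fun m ω => (hτbij m ω).comp (Equiv.sumComm _ _).bijective)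
    (fun m => (hnoise m).comp measurable_id (hswap m)) hb hlam0 heig₁ hsel hscreen₂ hsize₂
  have hmeas : ∀ i, AEMeasurable (ε i) P := fun i => (hid i).aemeasurable
  constructor
  · have h := (hclt.add_of_tendstoInMeasure_const herr₁ fun m =>
      RefittedCV.aemeasurable_refitError hmeas (hX m) (hτ m) (hsel m)
        (β m)).add_of_tendstoInMeasure_const herr₂ fun m =>
      RefittedCV.aemeasurable_refitError hmeas (hX m) (hτ' m) (hsel m) (β m)
    simp only [add_zero] at h
    exact h.congr (fun m => ae_of_all _ fun ω => (RefittedCV.sqrt_mul_rcv_sub (sel m) (β m)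
      (hτbij m ω) (X m ω) (fun i => ε i ω) (σ ^ 2)).symm) (ae_of_all _ fun _ => rfl)
  · exact hclt.congr (fun m => ae_of_all _ fun ω => (RefittedCV.sqrt_mul_oracle_sub (β m) (X m ω)
      (fun i => ε i ω) (σ ^ 2)).symm) (ae_of_all _ fun _ => rfl)
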